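/- Let $n\in\mathbb{N}$ and let $B^c=[b^c_{ij}],B^d=[b^d_{ij}]\in\mathbb{R}^{n\times n}$ have zero diagonals. For such a matrix $B=[b_{ij}]$, let $\mathscr{G}(B)$ be the signed digraph on the vertices $v_1,\dots,v_n$ with an arc $(v_j,v_i)$ of weight $b_{ij}$ exactly when $b_{ij}\neq 0$, and let $L_B$ be its Laplacian matrix, with diagonal entries $(L_B)_{ii}=\sum_{j=1}^n|b_{ij}|$ and off-diagonal entries $(L_B)_{ij}=-b_{ij}$ for $i\neq j$. Suppose that $\mathscr{G}(B^c)$ and $\mathscr{G}(B^d)$ are sign-inconsistent, i.e. $b^c_{ij}b^d_{ij}<0$ for some $i,j$, and that the union of the two digraphs (the digraph on $v_1,\dots,v_n$ whose arc set is the union of the two arc sets) is strongly connected. Then there is a unique symmetric positive definite matrix $H\in\mathbb{R}^{n\times n}$ with $$(L_{B^c}+L_{B^d})^{\mathrm T}H+H(L_{B^c}+L_{B^d})=I .$$ For $\delta>1$ put $$\zeta=\frac{\lambda_{\max}(H)\,\lambda_{\max}\big((L_{B^c}+\delta L_{B^d})(L_{B^c}+\delta L_{B^d})^{\mathrm T}\big)}{2(\delta-1)},$$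 where $\lambda_{\max}$ denotes the largest eigenvalue. If $k>\zeta$ for some $\delta>1$, then for all $x_0,y_0\in\mathbb{R}^n$ the system $$\begin{bmatrix}\dot x(t)\\ \dot y(t)\end{bmatrix}=\begin{bmatrix}-L_{B^c}&I\\-kL_{B^d}&-kI\end{bmatrix}\begin{bmatrix}x(t)\\ y(t)\end{bmatrix},\qquad t\ge 0,$$ has a solution with $x(0)=x_0$ and $y(0)=y_0$, and every such solution satisfies $\lim_{t\to\infty}x(t)=0$ and $\lim_{t\to\infty}y(t)=0$. -/

import Mathlib

open Filter Topology

namespace SignedNetwork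

/-- The digraph of the signed digraph with adjacency matrix `B` on the vertices `0, …, n-1`:
there is an arc from `j` to `i` exactly when `B i j ≠ 0`. -/
def toDigraph {n : ℕ} (B : Matrix (Fin n) (Fin n) ℝ) : Digraph (Fin n) where
  Adj j i := B i j ≠ 0

/-- `B` is the adjacency matrix of a signed digraph: there are no self-loops. -/
def IsAdjacency {n : ℕ} (B : Matrix (Fin n) (Fin n) ℝ) : Prop :=
  ∀ i, B i i = 0

/-- A digraph is strongly connected if for every pair of distinct vertices there is a directed
path from the first to the second. -/
def StronglyConnected {V : Type*} (G : Digraph V) : Prop :=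
  ∀ u v, u ≠ v → Relation.TransGen G.Adj u v

/-- Two signed digraphs are sign-consistent if no two corresponding weights have opposite signs. -/
def SignConsistent {n : ℕ} (Bc Bd : Matrix (Fin n) (Fin n) ℝ) : Prop :=
  ∀ i j, 0 ≤ Bc i j * Bd i j

/-- The Laplacian matrix of a signed digraph: the `i`-th diagonal entry is the sum of the absolute
values of the weights of the arcs into `i` (non-neighbours contribute `0`), and the off-diagonal
entries are the negated weights. -/
def laplacian {n : ℕ} (B : Matrix (Fin n) (Fin n) ℝ) : Matrix (Fin n) (Fin n) ℝ :=
  Matrix.of fun i j => if i = j then ∑ k, |B i k| else -B i j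

/-- The system matrix `[[-L_{Bc}, I], [-k L_{Bd}, -k I]]`. -/
def systemMatrix {n : ℕ} (Bc Bd : Matrix (Fin n) (Fin n) ℝ) (k : ℝ) :
    Matrix (Fin n ⊕ Fin n) (Fin n ⊕ Fin n) ℝ :=
  Matrix.fromBlocks (-laplacian Bc) 1 (-(k • laplacian Bd)) (-(k • 1))

/-- `(x, y)` solves the linear system with matrix `systemMatrix Bc Bd k` on `[0, ∞)`. -/
def IsSolution {n : ℕ} (Bc Bd : Matrix (Fin n) (Fin n) ℝ) (k : ℝ)
    (x y : ℝ → Fin n → ℝ) : Prop :=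
  ∀ t ∈ Set.Ici (0 : ℝ),
    HasDerivWithinAt (fun s => Sum.elim (x s) (y s))
      ((systemMatrix Bc Bd k).mulVec (Sum.elim (x t) (y t))) (Set.Ici 0) t

/-- Neutralization: for all initial states there is a solution, and every solution with these
initial states tends to zero. -/
def Neutralization {n : ℕ} (Bc Bd : Matrix (Fin n) (Fin n) ℝ) (k : ℝ) : Prop :=
  ∀ x₀ y₀ : Fin n → ℝ,
    (∃ x y, IsSolution Bc Bd k x y ∧ x 0 = x₀ ∧ y 0 = y₀) ∧
    ∀ x y, IsSolution Bc Bd k x y → x 0 = x₀ → y 0 = y₀ →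
      Tendsto x atTop (𝓝 0) ∧ Tendsto y atTop (𝓝 0)

/-- The largest eigenvalue of a square real matrix; used only for symmetric matrices, all of whose
eigenvalues are real. -/
noncomputable def lambdaMax {n : ℕ} (A : Matrix (Fin n) (Fin n) ℝ) : ℝ :=
  sSup (spectrum ℝ A)

/-- `H` is a (symmetric) positive definite solution of the Lyapunov equation
`(L_{Bc} + L_{Bd})ᵀ H + H (L_{Bc} + L_{Bd}) = I`. -/
def IsLyapunovSolution {n : ℕ} (Bc Bd H : Matrix (Fin n) (Fin n) ℝ) : Prop :=
  H.PosDef ∧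
    (laplacian Bc + laplacian Bd).transpose * H + H * (laplacian Bc + laplacian Bd) = 1

/-- The threshold `ζ` for the damping rate. -/
noncomputable def zeta {n : ℕ} (Bc Bd H : Matrix (Fin n) (Fin n) ℝ) (δ : ℝ) : ℝ :=
  lambdaMax H *
      lambdaMax ((laplacian Bc + δ • laplacian Bd) * (laplacian Bc + δ • laplacian Bd).transpose) /
    (2 * (δ - 1))

end SignedNetwork

open Matrix

/-! ### Powers of elements with spectrum in the open unit disc. -/

section PowTendsto

/-! Let L be the sum of the two Laplacians. It is weakly diagonally dominant, strictly so in a row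
where two weights have opposite signs. Strong connectivity spreads this strictness, so the spectrum
of L lies in the open right half-plane (`isPositiveStable_laplacian_add`), and Lyapunov's theorem
yields H (`existsUnique_lyapunov`, by the Cayley transform).

For the dynamics put e = y/k and w = x + e. Then w' = -Lx, and V = wᵀHw + (δ - 1)eᵀHe satisfies V' =
-|x|² - 2eᵀHMx - 2(δ - 1)k eᵀHe with M = L_{Bc} + δL_{Bd}. By `neg_two_mul_cross_le` the condition k
> ζ is what lets the outer terms absorb the cross term, so V decays exponentially
(`neutralization_of_lt`). -/

theorem spectrum.tendsto_pow_nhds_zero {A : Type*} [NormedRing A] [NormedAlgebra ℂ A]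
    [CompleteSpace A] [Nontrivial A] (a : A) (ha : ∀ z ∈ spectrum ℂ a, ‖z‖ < 1) :
    Tendsto (fun m : ℕ => a ^ m) atTop (𝓝 0) := by
  have h1 : spectralRadius ℂ a < (1 : NNReal) :=
    spectrum.spectralRadius_lt_of_forall_lt a fun z hz => by exact_mod_cast ha z hz
  obtain ⟨r, hr, hr1⟩ := ENNReal.lt_iff_exists_nnreal_btwn.1 h1
  -- Gelfand's formula gives the eventual bound ‖a ^ m‖ ≤ r ^ m with r < 1.
  have h2 := (spectrum.pow_nnnorm_pow_one_div_tendsto_nhds_spectralRadius a).eventually_lt_const hr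
  have h3 : Tendsto (fun m : ℕ => (r : ℝ) ^ m) atTop (𝓝 0) :=
    tendsto_pow_atTop_nhds_zero_of_lt_one r.2 (by exact_mod_cast hr1)
  refine squeeze_zero_norm' ?_ h3
  filter_upwards [h2, eventually_gt_atTop 0] with m hm hm0
  have h4 : (‖a ^ m‖₊ : ENNReal) ≤ (r : ENNReal) ^ m := by
    have := ENNReal.rpow_le_rpow hm.le (Nat.cast_nonneg (α := ℝ) m)
    rwa [← ENNReal.rpow_mul, one_div, inv_mul_cancel₀ (by positivity), ENNReal.rpow_one,
      ENNReal.rpow_natCast] at this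
  exact_mod_cast h4

attribute [local instance] Matrix.linftyOpNormedRing Matrix.linftyOpNormedAlgebra

theorem Matrix.tendsto_pow_apply_nhds_zero {ι : Type*} [Fintype ι] [DecidableEq ι]
    (A : Matrix ι ι ℂ) (hA : ∀ z ∈ spectrum ℂ A, ‖z‖ < 1) (i j : ι) :
    Tendsto (fun m : ℕ => (A ^ m) i j) atTop (𝓝 0) := by
  have : Nonempty ι := ⟨i⟩
  have h := spectrum.tendsto_pow_nhds_zero A hA
  exact ((continuous_apply j).comp (continuous_apply i)).tendsto (0 : Matrix ι ι ℂ) |>.comp h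

end PowTendsto

/-! ### Lyapunov's theorem through the Cayley transform. -/

section Lyapunov

theorem Matrix.dotProduct_transpose_mul_mul_mulVec {ι : Type*} [Fintype ι] (A X : Matrix ι ι ℝ) (u : ι → ℝ) :
    u ⬝ᵥ (Aᵀ * X * A) *ᵥ u = (A *ᵥ u) ⬝ᵥ X *ᵥ (A *ᵥ u) := by
  rw [← mulVec_mulVec, ← mulVec_mulVec, dotProduct_mulVec u Aᵀ, vecMul_transpose]

variable {ι : Type*} [Fintype ι] [DecidableEq ι]

/-- All complex eigenvalues of the real matrix `L` lie in the open right half-plane. -/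
def Matrix.IsPositiveStable (L : Matrix ι ι ℝ) : Prop :=
  ∀ (v : ι → ℂ) (μ : ℂ), μ.re ≤ 0 → L.map (algebraMap ℝ ℂ) *ᵥ v = μ • v → v = 0

namespace Matrix.IsPositiveStable

variable {L : Matrix ι ι ℝ}

theorem isUnit_add_one (hL : L.IsPositiveStable) : IsUnit (L + 1) := by
  rw [Matrix.isUnit_iff_isUnit_det, isUnit_iff_ne_zero]
  intro h0
  have h1 : (L.map (algebraMap ℝ ℂ) + 1).det = 0 := by
    have := (algebraMap ℝ ℂ).map_det (L + 1)
    rw [h0, map_zero] at this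
    rw [this]
    congr 1
    simp [Matrix.map_add]
  obtain ⟨v, hv, hv0⟩ := Matrix.exists_mulVec_eq_zero_iff.2 h1
  refine hv (hL v (-1) (by simp) ?_)
  rw [add_mulVec, one_mulVec] at hv0
  simpa using eq_neg_of_add_eq_zero_left hv0

/-- The Cayley transform of `L` has powers tending to zero. -/
theorem exists_cayley (hL : L.IsPositiveStable) :
    ∃ C : Matrix ι ι ℝ, C * (L + 1) = L - 1 ∧
      ∀ i j, Tendsto (fun m : ℕ => (C ^ m) i j) atTop (𝓝 0) := by
  obtain ⟨U, hU⟩ := hL.isUnit_add_one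
  refine ⟨(L - 1) * (U⁻¹ : (Matrix ι ι ℝ)ˣ), by rw [← hU, mul_assoc]; simp, ?_⟩
  set C := (L - 1) * ((U⁻¹ : (Matrix ι ι ℝ)ˣ) : Matrix ι ι ℝ) with hC
  have hCL : C * (L + 1) = L - 1 := by rw [hC, ← hU, mul_assoc]; simp
  set f := (algebraMap ℝ ℂ).mapMatrix (m := ι)
  have hfL : f C * (f L + 1) = f L - 1 := by
    rw [← map_one f, ← map_add, ← map_mul, hCL, map_sub]
  have hspec : ∀ z ∈ spectrum ℂ (f C), ‖z‖ < 1 := by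
    intro z hz
    by_contra! hz1
    rw [spectrum.mem_iff, Matrix.isUnit_iff_isUnit_det, isUnit_iff_ne_zero, not_not] at hz
    -- Multiplying by L + 1 clears the inverse in C: a kernel vector u satisfies (1 - z)Lu = (1 +
    -- z)u. For ‖z‖ ≥ 1, z ≠ 1, the eigenvalue (1 + z)/(1 - z) has real part ≤ 0; z = 1 would force
    -- 2u = 0.
    have h1 : ((algebraMap ℂ (Matrix ι ι ℂ) z - f C) * (f L + 1)).det = 0 := by
      rw [det_mul, hz, zero_mul]
    rw [sub_mul, hfL, Algebra.algebraMap_eq_smul_one, smul_mul_assoc, one_mul] at h1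
    obtain ⟨u, hu, hu0⟩ := Matrix.exists_mulVec_eq_zero_iff.2 h1
    simp only [sub_mulVec, smul_mulVec, add_mulVec, one_mulVec] at hu0
    have h2 : (1 - z) • (f L *ᵥ u) = (1 + z) • u := by
      funext i
      have := congrFun hu0 i
      simp only [Pi.sub_apply, Pi.add_apply, Pi.smul_apply, smul_eq_mul, Pi.zero_apply] at this ⊢
      linear_combination -this
    by_cases hz' : z = 1
    · subst hz'
      rw [sub_self, zero_smul, eq_comm, smul_eq_zero] at h2
      rcases h2 with h2 | h2
      · norm_num at h2
      · exact hu h2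
    · have hz2 : 1 - z ≠ 0 := sub_ne_zero.2 (Ne.symm hz')
      refine hu (hL u ((1 + z) / (1 - z)) ?_ ?_)
      · rw [Complex.div_re, ← add_div]
        refine div_nonpos_of_nonpos_of_nonneg ?_ (Complex.normSq_nonneg _)
        have : 1 ≤ Complex.normSq z := by
          rw [Complex.normSq_eq_norm_sq]; nlinarith
        rw [Complex.normSq_apply] at this
        simp
        nlinarith
      · rw [div_eq_inv_mul, mul_smul, ← h2, inv_smul_smul₀ hz2]
        rfl
  intro i j
  have h := Matrix.tendsto_pow_apply_nhds_zero (f C) hspec i j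
  simp_rw [← map_pow] at h
  have h' := (Complex.continuous_re.tendsto _).comp h
  exact h'

/-- Passes from the Lyapunov operator to the discrete operator X - CᵀXC, which can be iterated. -/
theorem cayley_stein {C X : Matrix ι ι ℝ} (hC : C * (L + 1) = L - 1) :
    (L + 1)ᵀ * (X - Cᵀ * X * C) * (L + 1) = 2 • (Lᵀ * X + X * L) := by
  have h1 : (L + 1)ᵀ * Cᵀ = (L - 1)ᵀ := by rw [← transpose_mul, hC]
  calc (L + 1)ᵀ * (X - Cᵀ * X * C) * (L + 1)
      = (L + 1)ᵀ * X * (L + 1) - ((L + 1)ᵀ * Cᵀ) * X * (C * (L + 1)) := by noncomm_ring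
    _ = _ := by
      rw [h1, hC, transpose_add, transpose_sub, transpose_one]; noncomm_ring

/-- A solution is fixed by X ↦ CᵀXC, hence by all its iterates, and these tend to 0. -/
theorem lyapunov_injective (hL : L.IsPositiveStable) {X : Matrix ι ι ℝ}
    (hX : Lᵀ * X + X * L = 0) : X = 0 := by
  obtain ⟨C, hC, hlim⟩ := hL.exists_cayley
  have hU := hL.isUnit_add_one
  have hUt : IsUnit (L + 1)ᵀ := (Matrix.isUnit_transpose _).2 hU
  have h1 : X = Cᵀ * X * C := by
    have := cayley_stein (X := X) hC
    rw [hX, smul_zero, hU.mul_left_eq_zero, hUt.mul_right_eq_zero] at this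
    exact sub_eq_zero.1 this
  have h2 : ∀ m : ℕ, X = (C ^ m)ᵀ * X * C ^ m := by
    intro m
    induction m with
    | zero => simp
    | succ m ih =>
      calc X = Cᵀ * X * C := h1
        _ = Cᵀ * ((C ^ m)ᵀ * X * C ^ m) * C := by rw [← ih]
        _ = _ := by rw [pow_succ, transpose_mul]; simp only [mul_assoc]
  have hlim' : Tendsto (fun m : ℕ => C ^ m) atTop (𝓝 (0 : Matrix ι ι ℝ)) :=
    tendsto_pi_nhds.2 fun i => tendsto_pi_nhds.2 fun j => hlim i j
  have hcont : Continuous fun D : Matrix ι ι ℝ => Dᵀ * X * D := by fun_prop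
  have h3 := (hcont.tendsto 0).comp hlim'
  simp only [mul_zero] at h3
  refine tendsto_nhds_unique (tendsto_const_nhds (f := atTop (α := ℕ))) (h3.congr fun m => ?_)
  exact (h2 m).symm

/-- The form vᵀHv does not increase under v ↦ Cv and tends to 0 along Cᵐv, so it is nonnegative. The
drop 2|u|² in one step, where v = (L + 1)u, makes it positive. -/
theorem posDef_of_lyapunov (hL : L.IsPositiveStable) {H : Matrix ι ι ℝ} (hsymm : Hᵀ = H)
    (hH : Lᵀ * H + H * L = 1) : H.PosDef := by
  obtain ⟨C, hC, hlim⟩ := hL.exists_cayley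
  obtain ⟨U, hU⟩ := hL.isUnit_add_one
  have hst := cayley_stein (X := H) hC
  rw [hH] at hst
  have hstep : ∀ u : ι → ℝ, ((L + 1) *ᵥ u) ⬝ᵥ H *ᵥ ((L + 1) *ᵥ u) =
      (C *ᵥ ((L + 1) *ᵥ u)) ⬝ᵥ H *ᵥ (C *ᵥ ((L + 1) *ᵥ u)) + 2 * (u ⬝ᵥ u) := by
    intro u
    have h := congrArg (fun Y => u ⬝ᵥ Y *ᵥ u) hst
    rw [dotProduct_transpose_mul_mul_mulVec, sub_mulVec, dotProduct_sub,
      dotProduct_transpose_mul_mul_mulVec, smul_mulVec, one_mulVec, dotProduct_smul,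
      nsmul_eq_mul, Nat.cast_ofNat] at h
    linarith
  have hstep' : ∀ v : ι → ℝ, ∃ u, (L + 1) *ᵥ u = v := fun v =>
    ⟨(U⁻¹ : (Matrix ι ι ℝ)ˣ) *ᵥ v, by rw [mulVec_mulVec, ← hU]; simp⟩
  have hmono : ∀ v : ι → ℝ, (C *ᵥ v) ⬝ᵥ H *ᵥ (C *ᵥ v) ≤ v ⬝ᵥ H *ᵥ v := by
    intro v
    obtain ⟨u, rfl⟩ := hstep' v
    rw [hstep u]
    have : 0 ≤ u ⬝ᵥ u := by simpa using dotProduct_star_self_nonneg u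
    linarith
  have hnonneg : ∀ v : ι → ℝ, 0 ≤ v ⬝ᵥ H *ᵥ v := by
    intro v
    have hle : ∀ m : ℕ, (C ^ m *ᵥ v) ⬝ᵥ H *ᵥ (C ^ m *ᵥ v) ≤ v ⬝ᵥ H *ᵥ v := by
      intro m
      induction m with
      | zero => simp
      | succ m ih =>
        rw [pow_succ', ← mulVec_mulVec]
        exact (hmono _).trans ih
    have hlim' : Tendsto (fun m : ℕ => C ^ m) atTop (𝓝 (0 : Matrix ι ι ℝ)) :=
      tendsto_pi_nhds.2 fun i => tendsto_pi_nhds.2 fun j => hlim i j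
    have hcont : Continuous fun D : Matrix ι ι ℝ => (D *ᵥ v) ⬝ᵥ H *ᵥ (D *ᵥ v) := by fun_prop
    have h3 := (hcont.tendsto 0).comp hlim'
    simp only [zero_mulVec, zero_dotProduct] at h3
    exact le_of_tendsto h3 (Eventually.of_forall hle)
  refine Matrix.PosDef.of_dotProduct_mulVec_pos (by simpa [Matrix.IsHermitian] using hsymm) ?_
  intro v hv
  obtain ⟨u, rfl⟩ := hstep' v
  rw [star_trivial, hstep u]
  have hu : u ≠ 0 := by rintro rfl; simp at hv
  have : 0 < u ⬝ᵥ u := by simpa using dotProduct_star_self_pos_iff.2 hu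
  linarith [hnonneg (C *ᵥ ((L + 1) *ᵥ u))]

/-- **Lyapunov's theorem** for a positive stable matrix. -/
theorem existsUnique_lyapunov (hL : L.IsPositiveStable) :
    ∃! H : Matrix ι ι ℝ, H.PosDef ∧ Lᵀ * H + H * L = 1 := by
  let T : Matrix ι ι ℝ →ₗ[ℝ] Matrix ι ι ℝ :=
    LinearMap.mulLeft ℝ Lᵀ + LinearMap.mulRight ℝ L
  -- In finite dimension injectivity gives existence; it also gives symmetry, since Hᵀ solves the
  -- same equation.
  have hinj : Function.Injective T :=
    (injective_iff_map_eq_zero T).2 fun X hX => hL.lyapunov_injective hX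
  obtain ⟨H, hH⟩ := LinearMap.injective_iff_surjective.1 hinj 1
  have hH' : Lᵀ * H + H * L = 1 := hH
  have hsymm : Hᵀ = H := by
    apply hinj
    rw [hH]
    change Lᵀ * Hᵀ + Hᵀ * L = 1
    have := congrArg transpose hH'
    rw [transpose_add, transpose_mul, transpose_mul, transpose_transpose, transpose_one,
      add_comm] at this
    exact this
  exact ⟨H, ⟨hL.posDef_of_lyapunov hsymm hH', hH'⟩, fun X hX => hinj (hX.2.trans hH.symm)⟩

end Matrix.IsPositiveStable

end Lyapunov

/-! ### Positive stability of the summed Laplacian. -/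

namespace SignedNetwork

variable {n : ℕ} {Bc Bd : Matrix (Fin n) (Fin n) ℝ}

theorem map_laplacian_mulVec {B : Matrix (Fin n) (Fin n) ℝ} (hB : IsAdjacency B)
    (v : Fin n → ℂ) (i : Fin n) :
    ((laplacian B).map (algebraMap ℝ ℂ) *ᵥ v) i =
      (∑ j, |B i j| : ℝ) * v i - ∑ j, (B i j : ℂ) * v j := by
  have h : ∀ j, ((laplacian B).map (algebraMap ℝ ℂ)) i j * v j =
      (if i = j then ((∑ j, |B i j| : ℝ) : ℂ) * v j else 0) - (B i j : ℂ) * v j := by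
    intro j
    by_cases hij : i = j
    · subst hij; simp [laplacian, hB i]
    · simp [laplacian, hij]
  simp only [mulVec, dotProduct, h, Finset.sum_sub_distrib, Finset.sum_ite_eq, Finset.mem_univ,
    if_true]

/-- A maximum modulus argument: an eigenvector with Re μ ≤ 0 has maximal modulus at every vertex
from which a maximal vertex can be reached, which contradicts strict dominance in row p. -/
theorem isPositiveStable_laplacian_add (hBc : IsAdjacency Bc) (hBd : IsAdjacency Bd)
    (hsign : ¬ SignConsistent Bc Bd)
    (hconn : StronglyConnected (toDigraph Bc ⊔ toDigraph Bd)) :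
    (laplacian Bc + laplacian Bd).IsPositiveStable := by
  intro v μ hμ hv
  simp only [SignConsistent, not_forall, not_le] at hsign
  obtain ⟨p, q, hpq⟩ := hsign
  obtain ⟨i₀, -, hi₀⟩ := Finset.exists_max_image Finset.univ (fun i => ‖v i‖) ⟨p, Finset.mem_univ p⟩
  replace hi₀ : ∀ j, ‖v j‖ ≤ ‖v i₀‖ := fun j => hi₀ j (Finset.mem_univ j)
  by_contra hv0
  have hm : 0 < ‖v i₀‖ := by
    obtain ⟨j, hj⟩ := Function.ne_iff.1 hv0
    exact (norm_pos_iff.2 hj).trans_le (hi₀ j)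
  set m := ‖v i₀‖
  have hterm : ∀ i j, |Bc i j + Bd i j| * ‖v j‖ ≤ (|Bc i j| + |Bd i j|) * m := fun i j =>
    mul_le_mul (abs_add_le _ _) (hi₀ j) (norm_nonneg _) (by positivity)
  -- As Re μ ≤ 0, subtracting μ from the diagonal entry cannot lower its modulus below that entry;
  -- the triangle inequality is then tight, term by term.
  have hrow : ∀ i, ‖v i‖ = m → ∀ j, (|Bc i j| + |Bd i j|) * m = |Bc i j + Bd i j| * ‖v j‖ := by
    intro i hi
    have h1 : ((∑ j, (|Bc i j| + |Bd i j|) : ℝ) - μ) * v i =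
        ∑ j, ((Bc i j + Bd i j : ℝ) : ℂ) * v j := by
      have h2 := congrFun hv i
      rw [Matrix.map_add _ (fun a b => map_add _ a b), add_mulVec, Pi.add_apply,
        map_laplacian_mulVec hBc, map_laplacian_mulVec hBd, Pi.smul_apply, smul_eq_mul] at h2
      simp only [Complex.ofReal_add, add_mul, Finset.sum_add_distrib] at h2 ⊢
      linear_combination h2
    have h3 : (∑ j, (|Bc i j| + |Bd i j|)) * m ≤ ∑ j, |Bc i j + Bd i j| * ‖v j‖ := by
      calc (∑ j, (|Bc i j| + |Bd i j|)) * m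
          ≤ ‖((∑ j, (|Bc i j| + |Bd i j|) : ℝ) : ℂ) - μ‖ * ‖v i‖ := by
            rw [hi]
            refine mul_le_mul_of_nonneg_right ?_ hm.le
            refine le_trans ?_ (Complex.re_le_norm _)
            rw [Complex.sub_re, Complex.ofReal_re]
            linarith
        _ = ‖∑ j, ((Bc i j + Bd i j : ℝ) : ℂ) * v j‖ := by rw [← norm_mul, h1]
        _ ≤ ∑ j, ‖((Bc i j + Bd i j : ℝ) : ℂ) * v j‖ := norm_sum_le _ _
        _ = _ := by simp only [norm_mul, Complex.norm_real, Real.norm_eq_abs]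
    rw [Finset.sum_mul] at h3
    have h4 := (Finset.sum_eq_sum_iff_of_le fun j _ => hterm i j).1
      (le_antisymm (Finset.sum_le_sum fun j _ => hterm i j) h3)
    exact fun j => (h4 j (Finset.mem_univ j)).symm
  have hprop : ∀ j i, (toDigraph Bc ⊔ toDigraph Bd).Adj j i → ‖v i‖ = m → ‖v j‖ = m := by
    intro j i hji hi
    have hpos : 0 < |Bc i j| + |Bd i j| := by
      rcases hji with h | h
      · exact add_pos_of_pos_of_nonneg (abs_pos.2 h) (abs_nonneg _)
      · exact add_pos_of_nonneg_of_pos (abs_nonneg _) (abs_pos.2 h)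
    refine le_antisymm (hi₀ j) (le_of_mul_le_mul_left ?_ hpos)
    rw [hrow i hi j]
    exact mul_le_mul_of_nonneg_right (abs_add_le _ _) (norm_nonneg _)
  have hpath : ∀ i, Relation.TransGen (toDigraph Bc ⊔ toDigraph Bd).Adj i i₀ → ‖v i‖ = m := by
    intro i hi
    induction hi using Relation.TransGen.head_induction_on with
    | single h => exact hprop _ _ h rfl
    | head h _ ih => exact hprop _ _ h ih
  have hp : ‖v p‖ = m := by
    by_cases h : p = i₀
    · rw [h]
    · exact hpath p (hconn p i₀ h)
  have h5 := hrow p hp q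
  have h6 : |Bc p q + Bd p q| < |Bc p q| + |Bd p q| := by
    refine lt_of_le_of_ne (abs_add_le _ _) fun h => ?_
    rcases abs_add_eq_add_abs_iff _ _ |>.1 h with h | h <;> nlinarith
  have h7 : |Bc p q + Bd p q| * ‖v q‖ ≤ |Bc p q + Bd p q| * m :=
    mul_le_mul_of_nonneg_left (hi₀ q) (abs_nonneg _)
  nlinarith

end SignedNetwork

/-! ### Quadratic forms along trajectories and linear differential equations. -/

theorem Matrix.dotProduct_mulVec_comm_of_symm {ι : Type*} [Fintype ι] {H : Matrix ι ι ℝ}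
    (hH : Hᵀ = H) (u v : ι → ℝ) : u ⬝ᵥ H *ᵥ v = v ⬝ᵥ H *ᵥ u := by
  rw [dotProduct_mulVec, ← mulVec_transpose, hH, dotProduct_comm]

theorem Matrix.two_mul_dotProduct_mulVec_of_lyapunov {ι : Type*} [Fintype ι] [DecidableEq ι]
    {H L : Matrix ι ι ℝ} (hH : Hᵀ = H) (h : Lᵀ * H + H * L = 1) (v : ι → ℝ) :
    2 * (v ⬝ᵥ H *ᵥ (L *ᵥ v)) = v ⬝ᵥ v := by
  have h1 := congrArg (fun Y => v ⬝ᵥ Y *ᵥ v) h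
  simp only [add_mulVec, dotProduct_add, one_mulVec, ← mulVec_mulVec] at h1
  rw [dotProduct_mulVec v Lᵀ, vecMul_transpose, dotProduct_mulVec_comm_of_symm hH (L *ᵥ v)] at h1
  rw [two_mul, h1]

theorem HasDerivWithinAt.dotProduct_mulVec_self {ι : Type*} [Fintype ι] {H : Matrix ι ι ℝ}
    (hH : Hᵀ = H) {f : ℝ → ι → ℝ} {f' : ι → ℝ} {s : Set ℝ} {t : ℝ}
    (hf : HasDerivWithinAt f f' s t) :
    HasDerivWithinAt (fun r => f r ⬝ᵥ H *ᵥ f r) (2 * (f t ⬝ᵥ H *ᵥ f')) s t := by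
  have hfi := hasDerivWithinAt_pi.1 hf
  have h : HasDerivWithinAt (fun r => f r ⬝ᵥ H *ᵥ f r)
      (∑ i, (f' i * (H *ᵥ f t) i + f t i * (H *ᵥ f') i)) s t := by
    refine HasDerivWithinAt.fun_sum fun i _ => (hfi i).mul ?_
    exact HasDerivWithinAt.fun_sum fun j _ => (hfi j).const_mul (H i j)
  convert h using 1
  rw [Finset.sum_add_distrib]
  change _ = f' ⬝ᵥ H *ᵥ f t + f t ⬝ᵥ H *ᵥ f'
  rw [dotProduct_mulVec_comm_of_symm hH f', two_mul]

/-- Exponential decay of a function satisfying a linear differential inequality. -/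
theorem le_mul_exp_of_hasDerivWithinAt_le {V V' : ℝ → ℝ} {c : ℝ}
    (hV : ∀ t ∈ Set.Ici (0 : ℝ), HasDerivWithinAt V (V' t) (Set.Ici 0) t)
    (hle : ∀ t ∈ Set.Ici (0 : ℝ), V' t ≤ -c * V t) {t : ℝ} (ht : 0 ≤ t) :
    V t ≤ V 0 * Real.exp (-c * t) := by
  have hd : ∀ t ∈ Set.Ici (0 : ℝ), HasDerivWithinAt (fun r => Real.exp (c * r) * V r)
      (Real.exp (c * t) * (c * 1) * V t + Real.exp (c * t) * V' t) (Set.Ici 0) t := fun t ht =>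
    (((hasDerivWithinAt_id t _).const_mul c).exp).mul (hV t ht)
  have hanti : AntitoneOn (fun r => Real.exp (c * r) * V r) (Set.Ici 0) := by
    refine antitoneOn_of_hasDerivWithinAt_nonpos (convex_Ici 0)
      (fun t ht => (hd t ht).continuousWithinAt)
      (fun t ht => (hd t (interior_subset ht)).mono interior_subset) fun t ht => ?_
    nlinarith [hle t (interior_subset ht), Real.exp_pos (c * t)]
  have h := hanti Set.self_mem_Ici ht ht
  simp only [mul_zero, Real.exp_zero, one_mul] at h
  rw [neg_mul, Real.exp_neg, ← div_eq_mul_inv, le_div_iff₀ (Real.exp_pos _), mul_comm]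
  exact h

theorem exists_hasDerivAt_mulVec {ι : Type*} [Fintype ι] [DecidableEq ι] (A : Matrix ι ι ℝ)
    (z₀ : ι → ℝ) : ∃ z : ℝ → ι → ℝ, z 0 = z₀ ∧ ∀ t, HasDerivAt z (A *ᵥ z t) t := by
  let T : (ι → ℝ) →L[ℝ] (ι → ℝ) := LinearMap.toContinuousLinearMap (Matrix.toLin' A)
  refine ⟨fun t => NormedSpace.exp (t • T) z₀, by simp, fun t => ?_⟩
  exact (hasDerivAt_exp_smul_const' T t).clm_apply (hasDerivAt_const t z₀) |>.congr_deriv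
    (by simp [T])

/-! ### Bounds by the largest eigenvalue. -/

namespace SignedNetwork

variable {n : ℕ}

theorem dotProduct_mulVec_le_lambdaMax {A : Matrix (Fin n) (Fin n) ℝ} (hA : A.IsHermitian)
    (v : Fin n → ℝ) : v ⬝ᵥ A *ᵥ v ≤ lambdaMax A * (v ⬝ᵥ v) := by
  have hbdd : BddAbove (spectrum ℝ A) := (Matrix.finite_spectrum A).bddAbove
  have hpsd : (algebraMap ℝ (Matrix (Fin n) (Fin n) ℝ) (lambdaMax A) - A).PosSemidef := by
    rw [Matrix.posSemidef_iff_isHermitian_and_spectrum_nonneg]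
    refine ⟨.sub (by simp [Matrix.IsHermitian, Matrix.algebraMap_eq_diagonal]) hA, ?_⟩
    rw [← spectrum.singleton_sub_eq]
    rintro _ ⟨_, rfl, z, hz, rfl⟩
    exact sub_nonneg.2 (le_csSup hbdd hz)
  have h := hpsd.dotProduct_mulVec_nonneg v
  rw [star_trivial, sub_mulVec, dotProduct_sub, Algebra.algebraMap_eq_smul_one, smul_mulVec,
    one_mulVec, dotProduct_smul, smul_eq_mul] at h
  linarith

theorem lambdaMax_nonneg {A : Matrix (Fin n) (Fin n) ℝ} (hA : A.PosSemidef) :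
    0 ≤ lambdaMax A :=
  Real.sSup_nonneg fun _ hz => (Matrix.posSemidef_iff_isHermitian_and_spectrum_nonneg.1 hA).2 hz

theorem mulVec_dotProduct_self_le_lambdaMax {H : Matrix (Fin n) (Fin n) ℝ} (hH : H.PosDef)
    (v : Fin n → ℝ) : (H *ᵥ v) ⬝ᵥ (H *ᵥ v) ≤ lambdaMax H * (v ⬝ᵥ H *ᵥ v) := by
  set w := H *ᵥ v with hw
  rcases eq_or_ne w 0 with h0 | h0
  · simp [h0]
  have hsymm : Hᵀ = H := by simpa [Matrix.IsHermitian] using hH.isHermitian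
  have h1 := dotProduct_mulVec_le_lambdaMax hH.isHermitian w
  have h2 : 0 < w ⬝ᵥ H *ᵥ w := by simpa using hH.dotProduct_mulVec_pos h0
  have h3 : 0 < w ⬝ᵥ w := by simpa using dotProduct_star_self_pos_iff.2 h0
  have h4 : 0 < lambdaMax H := by
    by_contra! h
    nlinarith
  -- With λ = `lambdaMax H`, expanding and using wᵀHw ≤ λ|w|² leaves λ|w|² ≤ λ²vᵀHv, so no square
  -- root of H is needed.
  have h5 : 0 ≤ (lambdaMax H • v - w) ⬝ᵥ H *ᵥ (lambdaMax H • v - w) := by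
    simpa using hH.posSemidef.dotProduct_mulVec_nonneg (lambdaMax H • v - w)
  have h6 : v ⬝ᵥ H *ᵥ w = w ⬝ᵥ w := by
    rw [dotProduct_mulVec, ← mulVec_transpose, hsymm]
  rw [mulVec_sub, mulVec_smul, ← hw] at h5
  simp only [sub_dotProduct, dotProduct_sub, smul_dotProduct, dotProduct_smul, smul_eq_mul,
    h6] at h5
  refine le_of_mul_le_mul_left ?_ h4
  linarith

theorem tendsto_zero_of_quadratic {H : Matrix (Fin n) (Fin n) ℝ} (hH : H.PosDef)
    {f : ℝ → Fin n → ℝ} {l : Filter ℝ} (hf : Tendsto (fun t => f t ⬝ᵥ H *ᵥ f t) l (𝓝 0)) :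
    Tendsto f l (𝓝 0) := by
  have h1 : Tendsto (fun t => (H *ᵥ f t) ⬝ᵥ (H *ᵥ f t)) l (𝓝 0) := by
    refine squeeze_zero (fun t => ?_) (fun t => mulVec_dotProduct_self_le_lambdaMax hH (f t))
      (by simpa using hf.const_mul (lambdaMax H))
    simpa using dotProduct_star_self_nonneg (H *ᵥ f t)
  have h2 : Tendsto (fun t => H *ᵥ f t) l (𝓝 0) := by
    refine tendsto_pi_nhds.2 fun i => ?_
    have h3 : Tendsto (fun t => (H *ᵥ f t) i ^ 2) l (𝓝 0) := by
      refine squeeze_zero (fun t => sq_nonneg _) (fun t => ?_) h1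
      rw [sq]
      exact Finset.single_le_sum (f := fun j => (H *ᵥ f t) j * (H *ᵥ f t) j)
        (fun j _ => mul_self_nonneg _) (Finset.mem_univ i)
    have h4 := (Real.continuous_sqrt.tendsto 0).comp h3
    simp only [Real.sqrt_zero, Function.comp_def, Real.sqrt_sq_eq_abs] at h4
    exact (tendsto_zero_iff_abs_tendsto_zero _).2 h4
  obtain ⟨U, rfl⟩ := hH.isUnit
  have hcont : Continuous fun v : Fin n → ℝ =>
      ((U⁻¹ : (Matrix (Fin n) (Fin n) ℝ)ˣ) : Matrix (Fin n) (Fin n) ℝ) *ᵥ v := by fun_prop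
  have h5 := (hcont.tendsto 0).comp h2
  simpa [Function.comp_def, mulVec_mulVec] using h5

/-! ### The system and its Lyapunov function. -/

variable {Bc Bd : Matrix (Fin n) (Fin n) ℝ}

theorem systemMatrix_mulVec (k : ℝ) (x y : Fin n → ℝ) :
    systemMatrix Bc Bd k *ᵥ Sum.elim x y =
      Sum.elim (-(laplacian Bc *ᵥ x) + y) (-(k • laplacian Bd *ᵥ x) - k • y) := by
  rw [systemMatrix, fromBlocks_mulVec]
  simp [neg_mulVec, smul_mulVec, sub_eq_add_neg]

theorem exists_isSolution (k : ℝ) (x₀ y₀ : Fin n → ℝ) :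
    ∃ x y, IsSolution Bc Bd k x y ∧ x 0 = x₀ ∧ y 0 = y₀ := by
  obtain ⟨z, hz0, hz⟩ := exists_hasDerivAt_mulVec (systemMatrix Bc Bd k) (Sum.elim x₀ y₀)
  refine ⟨fun t i => z t (Sum.inl i), fun t i => z t (Sum.inr i), fun t _ => ?_, ?_, ?_⟩
  · have h : ∀ t, Sum.elim (fun i => z t (Sum.inl i)) (fun i => z t (Sum.inr i)) = z t := fun t =>
      Sum.elim_comp_inl_inr (z t)
    simp only [h]
    exact (hz t).hasDerivWithinAt
  · simp [hz0]
  · simp [hz0]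

theorem IsSolution.hasDerivWithinAt {k : ℝ} {x y : ℝ → Fin n → ℝ} (h : IsSolution Bc Bd k x y)
    {t : ℝ} (ht : t ∈ Set.Ici (0 : ℝ)) :
    HasDerivWithinAt x (-(laplacian Bc *ᵥ x t) + y t) (Set.Ici 0) t ∧
      HasDerivWithinAt y (-(k • laplacian Bd *ᵥ x t) - k • y t) (Set.Ici 0) t := by
  have h1 := h t ht
  rw [systemMatrix_mulVec] at h1
  have h2 := hasDerivWithinAt_pi.1 h1
  exact ⟨hasDerivWithinAt_pi.2 fun i => h2 (Sum.inl i),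
    hasDerivWithinAt_pi.2 fun i => h2 (Sum.inr i)⟩

/-- The cross term in the derivative of the Lyapunov function is dominated. -/
theorem neg_two_mul_cross_le {H M : Matrix (Fin n) (Fin n) ℝ} (hH : H.PosDef) {s : ℝ} (hs : 0 < s)
    (e x : Fin n → ℝ) :
    -(2 * (e ⬝ᵥ H *ᵥ (M *ᵥ x))) ≤
      s * (x ⬝ᵥ x) + lambdaMax H * lambdaMax (M * Mᵀ) / s * (e ⬝ᵥ H *ᵥ e) := by
  have hsymm : Hᵀ = H := by simpa [Matrix.IsHermitian] using hH.isHermitian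
  have hMM : (M * Mᵀ).PosSemidef := by simpa using posSemidef_self_mul_conjTranspose M
  set g := Mᵀ *ᵥ (H *ᵥ e) with hg
  have h1 : e ⬝ᵥ H *ᵥ (M *ᵥ x) = g ⬝ᵥ x := by
    rw [dotProduct_mulVec, ← mulVec_transpose, hsymm, dotProduct_mulVec, ← mulVec_transpose]
  have h2 : g ⬝ᵥ g ≤ lambdaMax H * lambdaMax (M * Mᵀ) * (e ⬝ᵥ H *ᵥ e) := by
    have h3 : g ⬝ᵥ g = (H *ᵥ e) ⬝ᵥ (M * Mᵀ) *ᵥ (H *ᵥ e) := by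
      rw [← mulVec_mulVec, dotProduct_mulVec _ M, ← mulVec_transpose]
    rw [h3]
    refine (dotProduct_mulVec_le_lambdaMax hMM.isHermitian _).trans ?_
    rw [mul_comm (lambdaMax H), mul_assoc]
    exact mul_le_mul_of_nonneg_left (mulVec_dotProduct_self_le_lambdaMax hH e)
      (lambdaMax_nonneg hMM)
  -- Weighted Young inequality: -2 g·x ≤ s|x|² + |g|²/s.
  have h4 : 0 ≤ (s • x + g) ⬝ᵥ (s • x + g) := by
    simpa using dotProduct_star_self_nonneg (s • x + g)
  simp only [add_dotProduct, dotProduct_add, smul_dotProduct, dotProduct_smul, smul_eq_mul,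
    dotProduct_comm x g] at h4
  rw [h1]
  refine le_of_mul_le_mul_left ?_ hs
  have h5 : s * (s * (x ⬝ᵥ x) + lambdaMax H * lambdaMax (M * Mᵀ) / s * (e ⬝ᵥ H *ᵥ e)) =
      s * s * (x ⬝ᵥ x) + lambdaMax H * lambdaMax (M * Mᵀ) * (e ⬝ᵥ H *ᵥ e) := by
    field_simp
  rw [h5]
  linarith

theorem neutralization_of_lt {H : Matrix (Fin n) (Fin n) ℝ} (hH : IsLyapunovSolution Bc Bd H)
    {δ k : ℝ} (hδ : 1 < δ) (hk : zeta Bc Bd H δ < k) : Neutralization Bc Bd k := by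
  intro x₀ y₀
  refine ⟨exists_isSolution k x₀ y₀, fun x y hsol _ _ => ?_⟩
  obtain ⟨hpd, hlyap⟩ := hH
  have hsymm : Hᵀ = H := by simpa [Matrix.IsHermitian] using hpd.isHermitian
  set M := laplacian Bc + δ • laplacian Bd with hM
  have hMM : (M * Mᵀ).PosSemidef := by simpa using posSemidef_self_mul_conjTranspose M
  set μ := lambdaMax H * lambdaMax (M * Mᵀ) with hμ
  have hμ0 : 0 ≤ μ := mul_nonneg (lambdaMax_nonneg hpd.posSemidef) (lambdaMax_nonneg hMM)
  set K := 2 * (δ - 1) * k with hK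
  have hμK : μ < K := by
    have h : μ / (2 * (δ - 1)) < k := hk
    rwa [div_lt_iff₀' (by linarith)] at h
  have hK0 : 0 < K := hμ0.trans_lt hμK
  have hk0 : 0 < k := by
    by_contra! h
    nlinarith
  -- The midpoint of μ/K and 1, so that s < 1 and μ/s < K; it is positive even when μ = 0.
  set s := (μ + K) / (2 * K) with hs
  have hs0 : 0 < s := by positivity
  have hs1 : s < 1 := by rw [hs, div_lt_one (by positivity)]; linarith
  have hsK : μ / s < K := by
    rw [div_lt_iff₀ hs0, hs]
    have : K * ((μ + K) / (2 * K)) = (μ + K) / 2 := by field_simp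
    linarith
  set lam := lambdaMax H
  have hlam : 0 ≤ lam := lambdaMax_nonneg hpd.posSemidef
  set r := min (1 - s) (K - μ / s)
  have hr : 0 < r := lt_min (by linarith) (by linarith)
  -- From wᵀHw ≤ 2xᵀHx + 2eᵀHe, V has coefficients at most 2λ on |x|² and 2 + (δ - 1) on eᵀHe, where
  -- λ = `lam`; their sum serves for both.
  set D := 2 * lam + (δ + 1) with hD
  have hD0 : 0 < D := by linarith
  have hHnn : ∀ v, 0 ≤ v ⬝ᵥ H *ᵥ v := fun v => by
    simpa using hpd.posSemidef.dotProduct_mulVec_nonneg v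
  set e : ℝ → Fin n → ℝ := fun t => k⁻¹ • y t with he
  set w : ℝ → Fin n → ℝ := fun t => x t + e t with hw
  have hy : ∀ t, y t = k • e t := fun t => (smul_inv_smul₀ hk0.ne' (y t)).symm
  have hde : ∀ t ∈ Set.Ici (0 : ℝ),
      HasDerivWithinAt e (-(laplacian Bd *ᵥ x t) - k • e t) (Set.Ici 0) t := by
    intro t ht
    refine ((hsol.hasDerivWithinAt ht).2.const_smul k⁻¹).congr_deriv ?_
    rw [smul_sub, smul_neg, inv_smul_smul₀ hk0.ne', inv_smul_smul₀ hk0.ne', hy t]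
  have hdw : ∀ t ∈ Set.Ici (0 : ℝ), HasDerivWithinAt w
      (-((laplacian Bc + laplacian Bd) *ᵥ x t)) (Set.Ici 0) t := by
    intro t ht
    refine ((hsol.hasDerivWithinAt ht).1.add (hde t ht)).congr_deriv ?_
    rw [hy t, add_mulVec]
    abel
  -- The weight δ - 1 turns the cross-term matrix L_{Bc} + L_{Bd} into M.
  set V : ℝ → ℝ := fun t => w t ⬝ᵥ H *ᵥ w t + (δ - 1) * (e t ⬝ᵥ H *ᵥ e t) with hV
  have hdV : ∀ t ∈ Set.Ici (0 : ℝ), HasDerivWithinAt V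
      (2 * (w t ⬝ᵥ H *ᵥ (-((laplacian Bc + laplacian Bd) *ᵥ x t))) +
        (δ - 1) * (2 * (e t ⬝ᵥ H *ᵥ (-(laplacian Bd *ᵥ x t) - k • e t)))) (Set.Ici 0) t :=
    fun t ht => ((hdw t ht).dotProduct_mulVec_self hsymm).add
      (((hde t ht).dotProduct_mulVec_self hsymm).const_mul (δ - 1))
  have hVle : ∀ t, V t ≤ D * (x t ⬝ᵥ x t + e t ⬝ᵥ H *ᵥ e t) := by
    intro t
    have h1 := dotProduct_mulVec_le_lambdaMax hpd.isHermitian (x t)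
    have h2 := hHnn (x t - e t)
    have h3 := hHnn (e t)
    have h4 : 0 ≤ x t ⬝ᵥ x t := by simpa using dotProduct_star_self_nonneg (x t)
    simp only [hV, hw, mulVec_add, mulVec_sub, add_dotProduct, sub_dotProduct, dotProduct_add,
      dotProduct_sub] at h2 ⊢
    have h5 : 0 ≤ lam * (e t ⬝ᵥ H *ᵥ e t) := mul_nonneg hlam h3
    have h6 : 0 ≤ (δ + 1) * (x t ⬝ᵥ x t) := mul_nonneg (by linarith) h4
    rw [hD]
    linarith
  have hdVle : ∀ t ∈ Set.Ici (0 : ℝ),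
      2 * (w t ⬝ᵥ H *ᵥ (-((laplacian Bc + laplacian Bd) *ᵥ x t))) +
        (δ - 1) * (2 * (e t ⬝ᵥ H *ᵥ (-(laplacian Bd *ᵥ x t) - k • e t))) ≤ -(r / D) * V t := by
    intro t _
    have h1 : 2 * (x t ⬝ᵥ H *ᵥ ((laplacian Bc + laplacian Bd) *ᵥ x t)) = x t ⬝ᵥ x t :=
      two_mul_dotProduct_mulVec_of_lyapunov hsymm hlyap (x t)
    have h2 := neg_two_mul_cross_le (M := M) hpd hs0 (e t) (x t)
    have h3 := hHnn (e t)
    have h4 : 0 ≤ x t ⬝ᵥ x t := by simpa using dotProduct_star_self_nonneg (x t)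
    have h5 : r / D * V t ≤ r * (x t ⬝ᵥ x t + e t ⬝ᵥ H *ᵥ e t) := by
      rw [div_mul_eq_mul_div, div_le_iff₀ hD0, mul_assoc, mul_comm _ D]
      exact mul_le_mul_of_nonneg_left (hVle t) hr.le
    have h6 : r * (x t ⬝ᵥ x t) ≤ (1 - s) * (x t ⬝ᵥ x t) :=
      mul_le_mul_of_nonneg_right (min_le_left _ _) h4
    have h7 : r * (e t ⬝ᵥ H *ᵥ e t) ≤ (K - μ / s) * (e t ⬝ᵥ H *ᵥ e t) :=
      mul_le_mul_of_nonneg_right (min_le_right _ _) h3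
    simp only [hw, hM, add_mulVec, smul_mulVec, mulVec_add, mulVec_sub, mulVec_neg, mulVec_smul,
      add_dotProduct, dotProduct_add, dotProduct_sub, dotProduct_neg, dotProduct_smul,
      smul_eq_mul] at h1 h2 ⊢
    linarith
  have hV0 : Tendsto V atTop (𝓝 0) := by
    have hexp : Tendsto (fun t => V 0 * Real.exp (-(r / D) * t)) atTop (𝓝 0) := by
      have h : Tendsto (fun t : ℝ => -(r / D) * t) atTop atBot :=
        tendsto_id.const_mul_atTop_of_neg (neg_neg_of_pos (by positivity))
      simpa using (Real.tendsto_exp_atBot.comp h).const_mul (V 0)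
    refine squeeze_zero' (Eventually.of_forall fun t => ?_) ?_ hexp
    · exact add_nonneg (hHnn _) (mul_nonneg (by linarith) (hHnn _))
    · filter_upwards [eventually_ge_atTop 0] with t ht
      exact le_mul_exp_of_hasDerivWithinAt_le hdV hdVle ht
  have hw0 : Tendsto w atTop (𝓝 0) := by
    refine tendsto_zero_of_quadratic hpd (squeeze_zero (fun t => hHnn _) (fun t => ?_) hV0)
    exact le_add_of_nonneg_right (mul_nonneg (by linarith) (hHnn _))
  have he0 : Tendsto e atTop (𝓝 0) := by
    refine tendsto_zero_of_quadratic hpd (squeeze_zero (fun t => hHnn _) (fun t => ?_)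
      (by simpa using hV0.const_mul (δ - 1)⁻¹))
    rw [le_inv_mul_iff₀ (by linarith)]
    exact le_add_of_nonneg_left (hHnn _)
  constructor
  · simpa [hw] using hw0.sub he0
  · have h := he0.const_smul k
    simp only [← hy, smul_zero] at h
    exact h

end SignedNetwork

theorem theorem2 {n : ℕ} (Bc Bd : Matrix (Fin n) (Fin n) ℝ)
    (hBc : SignedNetwork.IsAdjacency Bc) (hBd : SignedNetwork.IsAdjacency Bd)
    (hsign : ¬ SignedNetwork.SignConsistent Bc Bd)
    (hconn : SignedNetwork.StronglyConnected
      (SignedNetwork.toDigraph Bc ⊔ SignedNetwork.toDigraph Bd)) :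
    (∃! H : Matrix (Fin n) (Fin n) ℝ, SignedNetwork.IsLyapunovSolution Bc Bd H) ∧
    ∀ H : Matrix (Fin n) (Fin n) ℝ, SignedNetwork.IsLyapunovSolution Bc Bd H →
      ∀ δ : ℝ, 1 < δ → ∀ k : ℝ, SignedNetwork.zeta Bc Bd H δ < k →
        SignedNetwork.Neutralization Bc Bd k :=
  ⟨(SignedNetwork.isPositiveStable_laplacian_add hBc hBd hsign hconn).existsUnique_lyapunov,
    fun _ hH _ hδ _ hk => SignedNetwork.neutralization_of_lt hH hδ hk⟩
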